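/- Let $(\widetilde M,g)$ be a smooth $n$-dimensional Lorentzian manifold (signature $(-,+,\dots,+)$) with Levi-Civita connection $\widetilde\nabla$, and let $(\widetilde M,g,\xi,\eta,\phi)$ be an $(LCS)_n$-manifold; that is, $\xi$ is a smooth vector field on $\widetilde M$ and $\alpha$ is a nowhere vanishing smooth function on $\widetilde M$ such that, with $\eta(X)=g(X,\xi)$, $$g(\xi,\xi)=-1,\qquad \widetilde\nabla_X\xi=\alpha\{X+\eta(X)\xi\},\qquad d\alpha(X)=\rho\,\eta(X)\ \text{ with }\ \rho=-\xi(\alpha)$$ for all vector fields $X$, and $\phi X=\frac1\alpha\widetilde\nabla_X\xi$. Let $\overline{\widetilde\nabla}$ be the quarter symmetric metric connection on $\widetilde M$, i.e. a linear connection with $\overline{\widetilde\nabla}g=0$ whose torsion is $T(X,Y)=\eta(Y)\phi X-\eta(X)\phi Y$. Let $M$ be an (immersed) submanifold of $\widetilde M$ of dimension $m<n$ which is $C$-totally real, i.e. $\xi$ is normal to $M$ at every point of $M$. Let $\nabla$ and $\overline\nabla$ be the connections induced on $M$ by $\widetilde\nabla$ and $\overline{\widetilde\nabla}$: for $X,Y$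 tangent to $M$, $\nabla_XY$ and $\overline\nabla_XY$ are the components tangent to $M$ of $\widetilde\nabla_XY$ and $\overline{\widetilde\nabla}_XY$. Let $R$ and $\overline R$ be the curvature tensors of $\nabla$ and $\overline\nabla$. For an orthonormal basis $e_1,\dots,e_m$ of $T_xM$ (with respect to the induced metric), let $$\tau(x)=\sum_{1\le i<j\le m}g(R(e_i,e_j)e_j,e_i),\qquad \overline\tau(x)=\sum_{1\le i<j\le m}g(\overline R(e_i,e_j)e_j,e_i)$$ be the scalar curvatures of $M$ at $x$ with respect to $\nabla$ and $\overline\nabla$. Then $\tau(x)=\overline\tau(x)$ for every $x\in M$ and every such basis. -/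

import Mathlib

open Bundle Manifold
open scoped ContDiff Topology

noncomputable section

namespace LCS

/-- The Euclidean model space `ℝⁿ`. -/
abbrev Model (n : ℕ) : Type := EuclideanSpace ℝ (Fin n)

/-- A linear connection on the tangent bundle of an `n`-dimensional manifold.
`D Y x v` is the covariant derivative of the vector field `Y` at `x` in the direction `v`. -/
abbrev Connection (n : ℕ) (N : Type*) [TopologicalSpace N] [ChartedSpace (Model n) N]
    [IsManifold (𝓡 n) ∞ N] : Type _ :=
  CovariantDerivative (𝓡 n) (Model n) (TangentSpace (𝓡 n) : N → Type)

/-- A smooth Lorentzian metric, of signature `(-, +, …, +)`: a smooth field of symmetric bilinear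
forms such that at every point some vector is timelike and the form is positive definite on the
orthogonal complement of that vector. -/
structure LorentzianMetric (n : ℕ) (N : Type*) [TopologicalSpace N] [ChartedSpace (Model n) N]
    [IsManifold (𝓡 n) ∞ N] where
  /-- The bilinear form on each tangent space. -/
  form (x : N) : TangentSpace (𝓡 n) x →L[ℝ] TangentSpace (𝓡 n) x →L[ℝ] ℝ
  symm (x : N) (v w : TangentSpace (𝓡 n) x) : form x v w = form x w v
  lorentzian (x : N) : ∃ t : TangentSpace (𝓡 n) x, form x t t < 0 ∧
    ∀ v : TangentSpace (𝓡 n) x, form x t v = 0 → v ≠ 0 → 0 < form x v v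
  contMDiff : ContMDiff (𝓡 n) ((𝓡 n).prod 𝓘(ℝ, Model n →L[ℝ] Model n →L[ℝ] ℝ)) ∞
    (fun x ↦ TotalSpace.mk' (Model n →L[ℝ] Model n →L[ℝ] ℝ) x (form x))

section Ambient

variable {n : ℕ} {N : Type*} [TopologicalSpace N] [ChartedSpace (Model n) N]
  [IsManifold (𝓡 n) ∞ N]

/-- `D` is a metric connection: `v(g(Y, Z)) = g(D_v Y, Z) + g(Y, D_v Z)`, i.e. `D g = 0`. -/
def IsMetric (g : LorentzianMetric n N) (D : Connection n N) : Prop :=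
  ∀ (x : N) (Y Z : (y : N) → TangentSpace (𝓡 n) y),
    MDifferentiableAt (𝓡 n) ((𝓡 n).prod 𝓘(ℝ, Model n)) (T% Y) x →
    MDifferentiableAt (𝓡 n) ((𝓡 n).prod 𝓘(ℝ, Model n)) (T% Z) x →
    ∀ v : TangentSpace (𝓡 n) x, mvfderiv (𝓡 n) (fun y ↦ g.form y (Y y) (Z y)) x v =
      g.form x (D Y x v) (Z x) + g.form x (Y x) (D Z x v)

/-- `D` is the Levi-Civita connection of `g`: metric and torsion free. -/
structure IsLeviCivita (g : LorentzianMetric n N) (D : Connection n N) : Prop where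
  metric : IsMetric g D
  torsion_eq_zero (x : N) (v w : TangentSpace (𝓡 n) x) : D.torsion x v w = 0

/-- The 1-form `η(X) = g(X, ξ)` associated with the vector field `ξ`. -/
def eta (g : LorentzianMetric n N) (ξ : (x : N) → TangentSpace (𝓡 n) x) (x : N) (v : TangentSpace (𝓡 n) x) : ℝ :=
  g.form x v (ξ x)

/-- The `(1,1)`-tensor field `φ X = (1/α) D_X ξ`. -/
def phi (D : Connection n N) (ξ : (x : N) → TangentSpace (𝓡 n) x) (α : N → ℝ) (x : N) (v : TangentSpace (𝓡 n) x) :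
    TangentSpace (𝓡 n) x :=
  (α x)⁻¹ • D ξ x v

/-- `(g, ξ, α)`, with Levi-Civita connection `D`, is a Lorentzian concircular structure:
`ξ` is a smooth unit timelike vector field with `D_X ξ = α (X + η(X) ξ)` for a smooth nowhere
vanishing function `α` such that `dα = ρ η`, where `ρ = -ξ(α)`. -/
structure IsLCSStructure (g : LorentzianMetric n N) (D : Connection n N)
    (ξ : (x : N) → TangentSpace (𝓡 n) x) (α : N → ℝ) : Prop where
  leviCivita : IsLeviCivita g D
  contMDiff_xi : ContMDiff (𝓡 n) ((𝓡 n).prod 𝓘(ℝ, Model n)) ∞ (T% ξ)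
  contMDiff_alpha : ContMDiff (𝓡 n) 𝓘(ℝ) ∞ α
  unit_timelike (x : N) : g.form x (ξ x) (ξ x) = -1
  alpha_ne_zero (x : N) : α x ≠ 0
  concircular (x : N) (v : TangentSpace (𝓡 n) x) : D ξ x v = α x • (v + eta g ξ x v • ξ x)
  d_alpha (x : N) (v : TangentSpace (𝓡 n) x) :
    mvfderiv (𝓡 n) α x v = -(mvfderiv (𝓡 n) α x (ξ x)) * eta g ξ x v

/-- `D'` is the quarter symmetric metric connection of the Lorentzian concircular structure:
a metric connection whose torsion is `T(X, Y) = η(Y) φ X - η(X) φ Y`. -/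
structure IsQuarterSymmetricMetric (g : LorentzianMetric n N) (D : Connection n N)
    (ξ : (x : N) → TangentSpace (𝓡 n) x) (α : N → ℝ) (D' : Connection n N) : Prop where
  metric : IsMetric g D'
  torsion_eq (x : N) (v w : TangentSpace (𝓡 n) x) :
    D'.torsion x v w = eta g ξ x w • phi D ξ α x v - eta g ξ x v • phi D ξ α x w

end Ambient

section Submanifold

variable {m n : ℕ} {M N : Type*} [TopologicalSpace M] [ChartedSpace (Model m) M]
  [IsManifold (𝓡 m) ∞ M] [TopologicalSpace N] [ChartedSpace (Model n) N] [IsManifold (𝓡 n) ∞ N]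

/-- The differential of `f : M → N` at `x`. -/
abbrev diff (f : M → N) (x : M) : TangentSpace (𝓡 m) x →L[ℝ] TangentSpace (𝓡 n) (f x) :=
  mfderiv (𝓡 m) (𝓡 n) f x

/-- The immersion `f : M → N` is `C`-totally real: `ξ` is normal to `M`. -/
def IsCTotallyReal (g : LorentzianMetric n N) (ξ : (x : N) → TangentSpace (𝓡 n) x) (f : M → N) : Prop :=
  ∀ (x : M) (v : TangentSpace (𝓡 m) x), g.form (f x) (ξ (f x)) (diff f x v) = 0

/-- The functional `v ↦ g(w, df v)` on `T_x M` defined by a vector `w` of `N` at `f x`. -/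
def pairing (g : LorentzianMetric n N) (f : M → N) (x : M) :
    TangentSpace (𝓡 n) (f x) →L[ℝ] TangentSpace (𝓡 m) x →L[ℝ] ℝ :=
  (ContinuousLinearMap.precomp ℝ (diff f x)).comp (g.form (f x))

/-- The induced metric `f^* g` on `M`: `(u, v) ↦ g(df u, df v)`. -/
def inducedMetric (g : LorentzianMetric n N) (f : M → N) (x : M) :
    TangentSpace (𝓡 m) x →L[ℝ] TangentSpace (𝓡 m) x →L[ℝ] ℝ :=
  (pairing g f x).comp (diff f x)

/-- The tangential part of a vector `w` of `N` at `f x`: the vector `u` of `M` at `x` with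
`g(df u, df v) = g(w, df v)` for all `v` tangent to `M` at `x`. (Where the induced metric is
nondegenerate, it is an invertible map `T_x M → (T_x M)^*`, and `w - df u` is normal to `M`.) -/
def tangentialPart (g : LorentzianMetric n N) (f : M → N) (x : M) :
    TangentSpace (𝓡 n) (f x) →L[ℝ] TangentSpace (𝓡 m) x :=
  (inducedMetric g f x).inverse.comp (pairing g f x)

/-- The covariant derivative of a vector field `s` along `f`, for the connection `D` of `N`. In
the coordinate frame `∂_i` of `N` around `f x`, where `s = ∑ sⁱ (∂_i ∘ f)`, it is
`D_v s = ∑ sⁱ(x) D_{df v} ∂_i + ∑ dsⁱ(v) ∂_i`. The field `FiberBundle.extend (Model n) (s x)` is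
`∑ sⁱ(x) ∂_i`, the local extension of `s x` with constant coefficients. -/
def covAlong (D : Connection n N) (f : M → N) (s : (y : M) → TangentSpace (𝓡 n) (f y)) (x : M) :
    TangentSpace (𝓡 m) x →L[ℝ] TangentSpace (𝓡 n) (f x) :=
  (D (FiberBundle.extend (Model n) (s x)) (f x)).comp (diff f x) +
    ((trivializationAt (Model n) (TangentSpace (𝓡 n) : N → Type) (f x)).symmL ℝ (f x)).comp
      (mvfderiv (𝓡 m) (fun y ↦ (trivializationAt (Model n) (TangentSpace (𝓡 n) : N → Type) (f x)
        ⟨f y, s y⟩).2) x)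

/-- The connection induced on `M` by the connection `D` of `N`: `∇_v Y` is the tangential part of
the covariant derivative of `df Y` along `f` (Gauss formula `D_X Y = ∇_X Y + h(X, Y)`). -/
def inducedConnection (g : LorentzianMetric n N) (D : Connection n N) (f : M → N)
    (Y : (y : M) → TangentSpace (𝓡 m) y) (x : M) : TangentSpace (𝓡 m) x →L[ℝ] TangentSpace (𝓡 m) x :=
  (tangentialPart g f x).comp (covAlong D f (fun y ↦ diff f y (Y y)) x)

/-- The curvature `R(X, Y)Z = ∇_X ∇_Y Z - ∇_Y ∇_X Z - ∇_{[X, Y]} Z` on vector fields of `M`. -/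
def curvatureField (cov : ((y : M) → TangentSpace (𝓡 m) y) → (x : M) → TangentSpace (𝓡 m) x →L[ℝ] TangentSpace (𝓡 m) x)
    (X Y Z : (y : M) → TangentSpace (𝓡 m) y) (x : M) : TangentSpace (𝓡 m) x :=
  cov (fun y ↦ cov Z y (Y y)) x (X x) - cov (fun y ↦ cov Z y (X y)) x (Y x) -
    cov Z x (VectorField.mlieBracket (𝓡 m) X Y x)

/-- The curvature tensor `R(u, v)w` at a point, computed with local smooth extensions of
`u`, `v`, `w`. -/
def curvature (cov : ((y : M) → TangentSpace (𝓡 m) y) → (x : M) → TangentSpace (𝓡 m) x →L[ℝ] TangentSpace (𝓡 m) x)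
    (x : M) (u v w : TangentSpace (𝓡 m) x) : TangentSpace (𝓡 m) x :=
  curvatureField cov (FiberBundle.extend (Model m) u) (FiberBundle.extend (Model m) v)
    (FiberBundle.extend (Model m) w) x

/-- The sectional curvature of the plane spanned by `u`, `v`, for the connection `cov` and the
scalar product `b` on `T_x M`:
`K(u, v) = b(R(u, v)v, u) / (b(u, u) b(v, v) - b(u, v)²)`. -/
def sectionalCurvature (cov : ((y : M) → TangentSpace (𝓡 m) y) → (x : M) → TangentSpace (𝓡 m) x →L[ℝ] TangentSpace (𝓡 m) x)
    (x : M) (b : TangentSpace (𝓡 m) x →L[ℝ] TangentSpace (𝓡 m) x →L[ℝ] ℝ) (u v : TangentSpace (𝓡 m) x) : ℝ :=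
  b (curvature cov x u v v) u / (b u u * b v v - b u v ^ 2)

/-- `e₁, …, e_m` is an orthonormal basis of `T_x M` for the scalar product `b`. -/
def IsOrthonormalBasis (x : M) (b : TangentSpace (𝓡 m) x →L[ℝ] TangentSpace (𝓡 m) x →L[ℝ] ℝ) (e : Fin m → TangentSpace (𝓡 m) x) : Prop :=
  ∀ i j, b (e i) (e j) = if i = j then 1 else 0

/-- The scalar curvature `τ = ∑_{i < j} K(e_i, e_j)` of `M` at `x`, computed in the orthonormal
basis `e` of `T_x M`. -/
def scalarCurvature (cov : ((y : M) → TangentSpace (𝓡 m) y) → (x : M) → TangentSpace (𝓡 m) x →L[ℝ] TangentSpace (𝓡 m) x)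
    (x : M) (b : TangentSpace (𝓡 m) x →L[ℝ] TangentSpace (𝓡 m) x →L[ℝ] ℝ) (e : Fin m → TangentSpace (𝓡 m) x) : ℝ :=
  ∑ i, ∑ j ∈ Finset.Ioi i, sectionalCurvature cov x b (e i) (e j)

end Submanifold

end LCS

end

/-!
Two metric connections on `N` differ by a tensor `S` such that `g(S(u, v), w)` is skew in `v`, `w`
and `S(u, v) - S(v, u)` is the difference of the torsions, so Koszul's trick expresses `S` in terms
of that difference. Hence, if the torsions have the same tangential part on vectors tangent to `M`,
so do the covariant derivatives along `M`, and the induced connections coincide. For the two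
connections of a Lorentzian concircular structure this applies because both torsions vanish on
vectors orthogonal to `ξ`.
-/

namespace LCS

open FiberBundle

section Difference

variable {𝕜 : Type*} [NontriviallyNormedField 𝕜] [CompleteSpace 𝕜]
  {E : Type*} [NormedAddCommGroup E] [NormedSpace 𝕜 E]
  {H : Type*} [TopologicalSpace H] {I : ModelWithCorners 𝕜 E H}
  {M : Type*} [TopologicalSpace M] [ChartedSpace H M]

theorem difference_apply_eq_extend
    {F : Type*} [NormedAddCommGroup F] [NormedSpace 𝕜 F] [FiniteDimensional 𝕜 F]
    {V : M → Type*} [TopologicalSpace (TotalSpace F V)] [∀ x, AddCommGroup (V x)]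
    [∀ x, Module 𝕜 (V x)] [∀ x, TopologicalSpace (V x)] [∀ x, IsTopologicalAddGroup (V x)]
    [∀ x, ContinuousSMul 𝕜 (V x)] [FiberBundle F V] [VectorBundle 𝕜 F V]
    [ContMDiffVectorBundle 1 F V I] (D D' : CovariantDerivative I F V) (x : M) (v : V x) :
    D.difference D' x v = D (extend F v) x - D' (extend F v) x := by
  have h := D.isCovariantDerivativeOnUniv.difference_apply D'.isCovariantDerivativeOnUniv
    (Set.mem_univ x) (mdifferentiableAt_extend I F v)
  rwa [extend_apply_self] at h

variable [FiniteDimensional 𝕜 E] [CompleteSpace E] [IsManifold I 2 M]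

theorem difference_sub_difference_eq_torsion_sub_torsion
    (D D' : CovariantDerivative I E (TangentSpace I : M → Type _)) (x : M)
    (u v : TangentSpace I x) :
    D.difference D' x v u - D.difference D' x u v = D.torsion x u v - D'.torsion x u v := by
  simp only [difference_apply_eq_extend, sub_apply, CovariantDerivative.torsion_apply_eq_extend,
    extend_apply_self]
  abel

end Difference

section Ambient

variable {n : ℕ} {N : Type*} [TopologicalSpace N] [ChartedSpace (Model n) N]
  [IsManifold (𝓡 n) ∞ N] {g : LorentzianMetric n N} {D D' : Connection n N}

theorem IsMetric.form_difference_skew (hD : IsMetric g D) (hD' : IsMetric g D') (x : N)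
    (u v w : TangentSpace (𝓡 n) x) :
    g.form x (D.difference D' x v u) w = -g.form x (D.difference D' x w u) v := by
  have hv := mdifferentiableAt_extend (𝓡 n) (Model n) v
  have hw := mdifferentiableAt_extend (𝓡 n) (Model n) w
  have h := (hD x _ _ hv hw u).symm.trans (hD' x _ _ hv hw u)
  simp only [extend_apply_self, g.symm x v] at h
  simp only [difference_apply_eq_extend, sub_apply, map_sub]
  linarith

theorem IsMetric.two_mul_form_difference (hD : IsMetric g D) (hD' : IsMetric g D') (x : N)
    (u v w : TangentSpace (𝓡 n) x) :
    2 * g.form x (D.difference D' x v u) w =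
      g.form x (D.torsion x u v - D'.torsion x u v) w -
        g.form x (D.torsion x v w - D'.torsion x v w) u +
        g.form x (D.torsion x w u - D'.torsion x w u) v := by
  simp only [← difference_sub_difference_eq_torsion_sub_torsion, map_sub, sub_apply]
  linarith [hD.form_difference_skew hD' x u v w, hD.form_difference_skew hD' x v w u,
    hD.form_difference_skew hD' x w u v]

end Ambient

section Submanifold

variable {m n : ℕ} {M N : Type*} [TopologicalSpace M] [ChartedSpace (Model m) M]
  [TopologicalSpace N] [ChartedSpace (Model n) N] [IsManifold (𝓡 n) ∞ N]
  {g : LorentzianMetric n N} {D D' : Connection n N} {f : M → N}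

theorem covAlong_sub_covAlong (D D' : Connection n N) (f : M → N)
    (s : (y : M) → TangentSpace (𝓡 n) (f y)) (x : M) (u : TangentSpace (𝓡 m) x) :
    covAlong D f s x u - covAlong D' f s x u = D.difference D' (f x) (s x) (diff f x u) := by
  simp only [covAlong, add_apply, ContinuousLinearMap.comp_apply, add_sub_add_right_eq_sub,
    difference_apply_eq_extend, sub_apply]

theorem form_difference_diff_eq_zero (hD : IsMetric g D) (hD' : IsMetric g D') {x : M}
    (hT : ∀ u v w : TangentSpace (𝓡 m) x,
      g.form (f x) (D.torsion (f x) (diff f x u) (diff f x v)) (diff f x w) =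
        g.form (f x) (D'.torsion (f x) (diff f x u) (diff f x v)) (diff f x w))
    (u v w : TangentSpace (𝓡 m) x) :
    g.form (f x) (D.difference D' (f x) (diff f x v) (diff f x u)) (diff f x w) = 0 := by
  have h := hD.two_mul_form_difference hD' (f x) (diff f x u) (diff f x v) (diff f x w)
  simp only [map_sub, sub_apply, hT, sub_self, add_zero] at h
  exact (mul_eq_zero_iff_left two_ne_zero).mp h

theorem inducedConnection_eq_of_form_torsion_eq (hD : IsMetric g D) (hD' : IsMetric g D')
    (hT : ∀ (x : M) (u v w : TangentSpace (𝓡 m) x),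
      g.form (f x) (D.torsion (f x) (diff f x u) (diff f x v)) (diff f x w) =
        g.form (f x) (D'.torsion (f x) (diff f x u) (diff f x v)) (diff f x w)) :
    inducedConnection (m := m) g D f = inducedConnection g D' f := by
  funext Y x
  ext1 u
  have hcov : pairing (m := m) g f x (covAlong D f (fun y ↦ diff f y (Y y)) x u -
      covAlong D' f (fun y ↦ diff f y (Y y)) x u) = 0 := by
    rw [covAlong_sub_covAlong]
    ext w
    exact form_difference_diff_eq_zero hD hD' (hT x) u (Y x) w
  rw [map_sub, sub_eq_zero] at hcov
  exact congrArg (inducedMetric g f x).inverse hcov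

theorem IsQuarterSymmetricMetric.torsion_diff_eq_zero {ξ : (x : N) → TangentSpace (𝓡 n) x}
    {α : N → ℝ} (hD' : IsQuarterSymmetricMetric g D ξ α D')
    (hξ : IsCTotallyReal (m := m) g ξ f) (x : M) (u v : TangentSpace (𝓡 m) x) :
    D'.torsion (f x) (diff f x u) (diff f x v) = 0 := by
  have hη (w : TangentSpace (𝓡 m) x) : eta g ξ (f x) (diff f x w) = 0 :=
    (g.symm _ _ _).trans (hξ x w)
  rw [hD'.torsion_eq, hη, hη, zero_smul, zero_smul, sub_zero]

end Submanifold

end LCS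

theorem theorem3p3_general {m n : ℕ}
    {N : Type*} [TopologicalSpace N] [ChartedSpace (LCS.Model n) N] [IsManifold (𝓡 n) ∞ N]
    {M : Type*} [TopologicalSpace M] [ChartedSpace (LCS.Model m) M] [IsManifold (𝓡 m) ∞ M]
    {g : LCS.LorentzianMetric n N} {D D' : LCS.Connection n N}
    (hD : LCS.IsMetric g D) (hD' : LCS.IsMetric g D')
    {f : M → N} (hf : IsImmersion (𝓡 m) (𝓡 n) ∞ f)
    (hT : ∀ (x : M) (u v w : TangentSpace (𝓡 m) x),
      g.form (f x) (D.torsion (f x) (LCS.diff f x u) (LCS.diff f x v)) (LCS.diff f x w) =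
        g.form (f x) (D'.torsion (f x) (LCS.diff f x u) (LCS.diff f x v)) (LCS.diff f x w))
    {x : M} {e : Fin m → TangentSpace (𝓡 m) x}
    (he : LCS.IsOrthonormalBasis x (LCS.inducedMetric g f x) e) :
    LCS.scalarCurvature (LCS.inducedConnection g D f) x (LCS.inducedMetric g f x) e =
      LCS.scalarCurvature (LCS.inducedConnection g D' f) x (LCS.inducedMetric g f x) e := by
  rw [LCS.inducedConnection_eq_of_form_torsion_eq hD hD' hT]

theorem theorem3p3 {m n : ℕ} (hmn : m < n)
    {N : Type*} [TopologicalSpace N] [T2Space N] [SecondCountableTopology N]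
    [ChartedSpace (LCS.Model n) N] [IsManifold (𝓡 n) ∞ N]
    {M : Type*} [TopologicalSpace M] [T2Space M] [SecondCountableTopology M]
    [ChartedSpace (LCS.Model m) M] [IsManifold (𝓡 m) ∞ M]
    (g : LCS.LorentzianMetric n N) (D : LCS.Connection n N)
    (ξ : (x : N) → TangentSpace (𝓡 n) x) (α : N → ℝ) (hLCS : LCS.IsLCSStructure g D ξ α)
    (D' : LCS.Connection n N) (hD' : LCS.IsQuarterSymmetricMetric g D ξ α D')
    (f : M → N) (hf : IsImmersion (𝓡 m) (𝓡 n) ∞ f) (hξ : LCS.IsCTotallyReal (m := m) g ξ f)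
    (x : M) (e : Fin m → TangentSpace (𝓡 m) x)
    (he : LCS.IsOrthonormalBasis x (LCS.inducedMetric g f x) e) :
    LCS.scalarCurvature (LCS.inducedConnection g D f) x (LCS.inducedMetric g f x) e =
      LCS.scalarCurvature (LCS.inducedConnection g D' f) x (LCS.inducedMetric g f x) e :=
  theorem3p3_general hLCS.leviCivita.metric hD'.metric hf
    (fun y u v w ↦ by rw [hLCS.leviCivita.torsion_eq_zero, hD'.torsion_diff_eq_zero hξ]) he
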